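/- For $x\in\mathbb R$ and $a,b,c,d\in\mathbb C$ put $$\varphi(x;a,b,c,d)=\frac{\Gamma(a+b+c+d)\,\Gamma(a+ix)\,\Gamma(b+ix)\,\Gamma(c-ix)\,\Gamma(d-ix)}{2\pi\,\Gamma(a+c)\,\Gamma(b+c)\,\Gamma(a+d)\,\Gamma(b+d)}.$$ Let $a,b\in\mathbb C$ with $\Re(a)>0$ and $\Re(b)>0$. Then $x\mapsto\varphi(x;a,b,\bar a,\bar b)$ is a probability density on $\mathbb R$ (it is real-valued, nonnegative, and integrates to $1$). If $X$ is a real random variable with this density, then $\mathbb E(X^2)<\infty$, $$\mathbb E(X)=-\frac{\Re(a)\,\Im(b)+\Re(b)\,\Im(a)}{\Re(a+b)},$$ $$\operatorname{Var}(X)=\frac{\Re(a)\,\Re(b)\left((\Re(a+b))^2+(\Im(a-b))^2\right)}{(\Re(a+b))^2\,\left(2\,\Re(a+b)+1\right)}.$$ -/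

import Mathlib

open MeasureTheory ProbabilityTheory ComplexConjugate

noncomputable section

/-- The continuous Hahn weight `φ(x; a, b, c, d)` with its normalizing constant,
for real `x` and complex `a, b, c, d`. It is complex valued in general. -/
def continuousHahn (x : ℝ) (a b c d : ℂ) : ℂ :=
  Complex.Gamma (a + b + c + d) *
      (Complex.Gamma (a + Complex.I * x) * Complex.Gamma (b + Complex.I * x) *
        Complex.Gamma (c - Complex.I * x) * Complex.Gamma (d - Complex.I * x)) /
    (2 * Real.pi * Complex.Gamma (a + c) * Complex.Gamma (b + c) *
      Complex.Gamma (a + d) * Complex.Gamma (b + d))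

/-- The measure on `ℝ` whose Lebesgue density is `x ↦ φ(x; a, b, conj a, conj b)`; these values of
`φ` are real and nonnegative when `a` and `b` have positive real parts. -/
def continuousHahnMeasure (a b : ℂ) : Measure ℝ :=
  volume.withDensity fun x : ℝ => ENNReal.ofReal (continuousHahn x a b (conj a) (conj b)).re

end

/-! The normalization is Barnes' first lemma, obtained by Fourier analysis. Substituting `s = σ(t)`
turns the Beta integral into the integral of `logisticKernel`, and multiplying the kernel by `exp (t
* z)` moves `(u, v)` to `(u + z, v - z)`. Hence its Fourier transform is a product of two Gamma
values over `Γ(u + v)`. Applying `∫ F̂ Ĝ = ∫ F (Ĝ)^` and Fourier inversion to two kernels leaves one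
more Beta integral (`integral_fourier_logisticKernel_mul`).

For the moments, `Γ(z + 1) = z Γ(z)` turns `(a + ix) φ` into a constant times `φ` with `a + 1` for
`a`, which again integrates to 1. Imaginary parts give the mean of `X + Im a`; raising `a` and `conj
a` together gives its second moment. -/

open FourierTransform

/-! ### Bounds and integrability for products of Gamma functions -/

theorem Complex.norm_Gamma_le_Gamma_re {s : ℂ} (hs : 0 < s.re) :
    ‖Complex.Gamma s‖ ≤ Real.Gamma s.re := by
  rw [Complex.Gamma_eq_integral hs, Real.Gamma_eq_integral hs, Complex.GammaIntegral]
  refine (norm_integral_le_integral_norm _).trans_eq ?_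
  refine setIntegral_congr_fun measurableSet_Ioi fun x hx => ?_
  have hx : 0 < x := hx
  simp [Complex.norm_cpow_eq_rpow_re_of_pos hx, Complex.norm_exp]

theorem Complex.continuous_Gamma_comp {f : ℝ → ℂ} (hf : Continuous f) (hre : ∀ x, 0 < (f x).re) :
    Continuous fun x => Complex.Gamma (f x) := by
  refine continuous_iff_continuousAt.2 fun x => ?_
  refine ContinuousAt.comp (f := f) (g := Complex.Gamma) ?_ hf.continuousAt
  refine (Complex.differentiableAt_Gamma _ fun m h => ?_).continuousAt
  have h1 := hre x
  rw [h] at h1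
  simp only [neg_re, natCast_re] at h1
  linarith [(Nat.cast_nonneg m : (0 : ℝ) ≤ m)]

theorem integrable_inv_normSq_add_I_mul {b : ℂ} (hb : 0 < b.re) :
    Integrable fun x : ℝ => (Complex.normSq (b + Complex.I * x))⁻¹ := by
  have h := ((integrable_inv_one_add_sq.comp_div hb.ne').comp_add_right b.im).const_mul
    ((b.re ^ 2)⁻¹)
  refine h.congr (ae_of_all _ fun x => ?_)
  simp only [Complex.normSq_apply]
  rw [← mul_inv]
  congr 1
  simp
  field_simp
  ring

theorem Complex.Gamma_mul_Gamma_eq_shift {u v : ℂ} (hu : 0 < u.re) (hv : 0 < v.re) :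
    Gamma u * Gamma v = Gamma (u + 1) * Gamma (v + 1) * (u * v)⁻¹ := by
  have hu0 : u ≠ 0 := by rintro rfl; simp at hu
  have hv0 : v ≠ 0 := by rintro rfl; simp at hv
  rw [Gamma_add_one u hu0, Gamma_add_one v hv0]
  field_simp

/-- Stirling is not needed: the functional equation extracts `(u * v)⁻¹` from Gamma factors bounded
on vertical lines, and AM-GM splits it into two integrable inverse squares. -/
theorem integrable_Gamma_mul_Gamma {b d : ℂ} (hb : 0 < b.re) (hd : 0 < d.re) :
    Integrable fun x : ℝ =>
      Complex.Gamma (b + Complex.I * x) * Complex.Gamma (d - Complex.I * x) := by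
  have hd' : 0 < (conj d).re := by simpa using hd
  have hB : ∀ x : ℝ, 0 < (b + Complex.I * x).re := by simpa using hb
  have hD : ∀ x : ℝ, 0 < (d - Complex.I * x).re := by simpa using hd
  refine Integrable.mono'
    (((integrable_inv_normSq_add_I_mul hb).add (integrable_inv_normSq_add_I_mul hd')).const_mul
      (Real.Gamma (b.re + 1) * Real.Gamma (d.re + 1)))
    (Continuous.aestronglyMeasurable ?_) (ae_of_all _ fun x => ?_)
  · exact (Complex.continuous_Gamma_comp (by fun_prop) hB).mul
      (Complex.continuous_Gamma_comp (by fun_prop) hD)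
  · have e1 : ‖Complex.Gamma (b + Complex.I * x + 1)‖ ≤ Real.Gamma (b.re + 1) := by
      refine (Complex.norm_Gamma_le_Gamma_re ?_).trans_eq ?_
      · rw [Complex.add_re, Complex.one_re]; linarith [hB x]
      · simp
    have e2 : ‖Complex.Gamma (d - Complex.I * x + 1)‖ ≤ Real.Gamma (d.re + 1) := by
      refine (Complex.norm_Gamma_le_Gamma_re ?_).trans_eq ?_
      · rw [Complex.add_re, Complex.one_re]; linarith [hD x]
      · simp
    have e3 : Complex.normSq (conj d + Complex.I * x) = ‖d - Complex.I * x‖ ^ 2 := by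
      rw [← Complex.normSq_eq_norm_sq, ← Complex.normSq_conj (d - _)]
      simp
    have hG : 0 < Real.Gamma (b.re + 1) := Real.Gamma_pos_of_pos (by linarith)
    rw [Complex.Gamma_mul_Gamma_eq_shift (hB x) (hD x), norm_mul, norm_mul]
    refine mul_le_mul (mul_le_mul e1 e2 (norm_nonneg _) hG.le) ?_ (norm_nonneg _)
      (mul_nonneg hG.le ((norm_nonneg _).trans e2))
    simp only [Pi.add_apply]
    rw [e3, Complex.normSq_eq_norm_sq, norm_inv, norm_mul, mul_inv, ← inv_pow, ← inv_pow]
    nlinarith [sq_nonneg (‖b + Complex.I * x‖⁻¹ - ‖d - Complex.I * x‖⁻¹),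
      sq_nonneg (‖b + Complex.I * x‖⁻¹), sq_nonneg (‖d - Complex.I * x‖⁻¹)]

theorem integrable_four_Gamma {a b c d : ℂ} (ha : 0 < a.re) (hb : 0 < b.re) (hc : 0 < c.re)
    (hd : 0 < d.re) : Integrable fun x : ℝ =>
      Complex.Gamma (a + Complex.I * x) * Complex.Gamma (b + Complex.I * x) *
        Complex.Gamma (c - Complex.I * x) * Complex.Gamma (d - Complex.I * x) := by
  have hA : ∀ x : ℝ, 0 < (a + Complex.I * x).re := by simpa using ha
  have hC : ∀ x : ℝ, 0 < (c - Complex.I * x).re := by simpa using hc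
  -- The pair `b, d` supplies integrability; the pair `a, c` is merely bounded.
  refine ((integrable_Gamma_mul_Gamma hb hd).bdd_mul (c := Real.Gamma a.re * Real.Gamma c.re)
    (f := fun x : ℝ => Complex.Gamma (a + Complex.I * x) * Complex.Gamma (c - Complex.I * x))
    (Continuous.aestronglyMeasurable ?_) (ae_of_all _ fun x => ?_)).congr
      (ae_of_all _ fun x => ?_)
  · exact (Complex.continuous_Gamma_comp (by fun_prop) hA).mul
      (Complex.continuous_Gamma_comp (by fun_prop) hC)
  · rw [norm_mul]
    have h1 := Complex.norm_Gamma_le_Gamma_re (hA x)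
    have h2 := Complex.norm_Gamma_le_Gamma_re (hC x)
    simp only [Complex.add_re, Complex.sub_re, Complex.mul_re, Complex.I_re, Complex.I_im,
      Complex.ofReal_re, Complex.ofReal_im] at h1 h2
    norm_num at h1 h2
    exact mul_le_mul h1 h2 (norm_nonneg _) (Real.Gamma_pos_of_pos ha).le
  · dsimp only
    ring

/-! ### The logistic kernel and its Fourier transform -/

/-- The function `σ(t) ^ u * σ(-t) ^ v`, where `σ` is the logistic sigmoid. -/
noncomputable def logisticKernel (u v : ℂ) (t : ℝ) : ℂ :=
  (Real.sigmoid t : ℂ) ^ u * (Real.sigmoid (-t) : ℂ) ^ v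

theorem continuous_logisticKernel (u v : ℂ) : Continuous (logisticKernel u v) := by
  have h : ∀ (w : ℂ) (t : ℝ), ContinuousAt (fun t : ℝ => (Real.sigmoid t : ℂ) ^ w) t := fun w t =>
    ContinuousAt.cpow (by fun_prop) continuousAt_const
      (Complex.ofReal_mem_slitPlane.2 (Real.sigmoid_pos t))
  have h' : ∀ w : ℂ, Continuous fun t : ℝ => (Real.sigmoid t : ℂ) ^ w := fun w =>
    continuous_iff_continuousAt.2 (h w)
  exact (h' u).mul ((h' v).comp continuous_neg)

/-- The Jacobian `σ' = σ(t) σ(-t)` cancels the `-1` in both Beta exponents. -/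
theorem abs_deriv_sigmoid_smul_eq_logisticKernel (u v : ℂ) (t : ℝ) :
    |Real.sigmoid t * (1 - Real.sigmoid t)| •
      ((Real.sigmoid t : ℂ) ^ (u - 1) * (1 - (Real.sigmoid t : ℂ)) ^ (v - 1)) =
        logisticKernel u v t := by
  have h1 := Real.sigmoid_pos t
  have h2 := Real.sigmoid_pos (-t)
  have h1' : (Real.sigmoid t : ℂ) ≠ 0 := by exact_mod_cast h1.ne'
  have h2' : (Real.sigmoid (-t) : ℂ) ≠ 0 := by exact_mod_cast h2.ne'
  have h3 : (1 - (Real.sigmoid t : ℂ)) = (Real.sigmoid (-t) : ℂ) := by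
    rw [Real.sigmoid_neg]; push_cast; rfl
  rw [h3, ← Real.sigmoid_neg, abs_of_pos (mul_pos h1 h2), logisticKernel,
    Complex.cpow_sub _ _ h1', Complex.cpow_sub _ _ h2', Complex.cpow_one, Complex.cpow_one,
    Complex.real_smul]
  push_cast
  field_simp

theorem integrable_logisticKernel {u v : ℂ} (hu : 0 < u.re) (hv : 0 < v.re) :
    Integrable (logisticKernel u v) := by
  have h := (intervalIntegrable_iff_integrableOn_Ioo_of_le zero_le_one).1
    (Complex.betaIntegral_convergent hu hv)
  rw [← Real.range_sigmoid, ← Set.image_univ, integrableOn_image_iff_integrableOn_abs_deriv_smul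
    MeasurableSet.univ (fun x _ => (Real.hasDerivAt_sigmoid x).hasDerivWithinAt)
    Real.sigmoid_injective.injOn, integrableOn_univ] at h
  simpa only [abs_deriv_sigmoid_smul_eq_logisticKernel] using h

theorem integral_logisticKernel (u v : ℂ) :
    ∫ t, logisticKernel u v t = Complex.betaIntegral u v := by
  rw [Complex.betaIntegral, intervalIntegral.integral_of_le zero_le_one,
    integral_Ioc_eq_integral_Ioo, ← Real.range_sigmoid, ← Set.image_univ,
    integral_image_eq_integral_abs_deriv_smul
      MeasurableSet.univ (fun x _ => (Real.hasDerivAt_sigmoid x).hasDerivWithinAt)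
      Real.sigmoid_injective.injOn, setIntegral_univ]
  simp only [abs_deriv_sigmoid_smul_eq_logisticKernel]

/-- Since `σ(-t) = exp (-t) σ(t)`, the exponential is `(σ(t) / σ(-t)) ^ z`. -/
theorem cexp_mul_logisticKernel (u v z : ℂ) (t : ℝ) :
    Complex.exp (t * z) * logisticKernel u v t = logisticKernel (u + z) (v - z) t := by
  have h1 := Real.sigmoid_pos t
  have h2 := Real.sigmoid_pos (-t)
  have h1' : (Real.sigmoid t : ℂ) ≠ 0 := by exact_mod_cast h1.ne'
  have h2' : (Real.sigmoid (-t) : ℂ) ≠ 0 := by exact_mod_cast h2.ne'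
  have hlog : Real.log (Real.sigmoid (-t)) = Real.log (Real.sigmoid t) - t := by
    rw [← Real.sigmoid_mul_rexp_neg, Real.log_mul h1.ne' (Real.exp_pos _).ne', Real.log_exp]
    ring
  simp only [logisticKernel]
  rw [Complex.cpow_def_of_ne_zero h1', Complex.cpow_def_of_ne_zero h1',
    Complex.cpow_def_of_ne_zero h2', Complex.cpow_def_of_ne_zero h2',
    ← Complex.ofReal_log h1.le, ← Complex.ofReal_log h2.le, hlog, ← Complex.exp_add,
    ← Complex.exp_add, ← Complex.exp_add]
  push_cast
  ring_nf

theorem fourier_logisticKernel (u v : ℂ) (w : ℝ) :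
    𝓕 (logisticKernel u v) w = Complex.betaIntegral (u + Complex.I * ((-(2 * Real.pi) * w : ℝ)))
      (v - Complex.I * ((-(2 * Real.pi) * w : ℝ))) := by
  rw [Real.fourier_real_eq_integral_exp_smul, ← integral_logisticKernel]
  refine integral_congr_ae (ae_of_all _ fun t => ?_)
  dsimp only
  rw [← cexp_mul_logisticKernel, smul_eq_mul]
  congr 2
  push_cast
  ring

theorem fourier_logisticKernel_eq_Gamma {u v : ℂ} (hu : 0 < u.re) (hv : 0 < v.re) (w : ℝ) :
    𝓕 (logisticKernel u v) w =
      Complex.Gamma (u + Complex.I * ((-(2 * Real.pi) * w : ℝ))) *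
        Complex.Gamma (v - Complex.I * ((-(2 * Real.pi) * w : ℝ))) / Complex.Gamma (u + v) := by
  rw [fourier_logisticKernel, Complex.betaIntegral_eq_Gamma_mul_div _ _ (by simpa using hu)
    (by simpa using hv)]
  congr 2
  ring

theorem integrable_fourier_logisticKernel {u v : ℂ} (hu : 0 < u.re) (hv : 0 < v.re) :
    Integrable (𝓕 (logisticKernel u v)) := by
  have h := ((integrable_Gamma_mul_Gamma hu hv).div_const (Complex.Gamma (u + v))).comp_mul_left'
    (R := -(2 * Real.pi)) (by simp [Real.pi_ne_zero])
  exact h.congr (ae_of_all _ fun w => (fourier_logisticKernel_eq_Gamma hu hv w).symm)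

theorem fourier_fourier_logisticKernel {u v : ℂ} (hu : 0 < u.re) (hv : 0 < v.re) (t : ℝ) :
    𝓕 (𝓕 (logisticKernel u v)) t = logisticKernel u v (-t) := by
  rw [← congrFun ((continuous_logisticKernel u v).fourierInv_fourier_eq
    (integrable_logisticKernel hu hv) (integrable_fourier_logisticKernel hu hv)) (-t),
    Real.fourierInv_eq_fourier_neg, neg_neg]

/-- The double transform reflects the second kernel, swapping `b` and `d`, so the exponents pair as
`a + d` and `b + c`. -/
theorem integral_fourier_logisticKernel_mul {a b c d : ℂ} (ha : 0 < a.re) (hb : 0 < b.re)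
    (hc : 0 < c.re) (hd : 0 < d.re) :
    ∫ w, 𝓕 (logisticKernel a c) w * 𝓕 (logisticKernel b d) w =
      Complex.betaIntegral (a + d) (b + c) := by
  have h := VectorFourier.integral_fourierIntegral_smul_eq_flip (L := innerₗ ℝ)
    (μ := volume) (ν := volume) Real.continuous_fourierChar continuous_inner
    (integrable_logisticKernel ha hc) (integrable_fourier_logisticKernel hb hd)
  rw [flip_innerₗ] at h
  change ∫ w, 𝓕 (logisticKernel a c) w • 𝓕 (logisticKernel b d) w =
    ∫ x, logisticKernel a c x • 𝓕 (𝓕 (logisticKernel b d)) x at h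
  simp only [smul_eq_mul] at h
  rw [h, ← integral_logisticKernel]
  refine integral_congr_ae (ae_of_all _ fun t => ?_)
  dsimp only
  rw [fourier_fourier_logisticKernel hb hd]
  have h1' : (Real.sigmoid t : ℂ) ≠ 0 := by exact_mod_cast (Real.sigmoid_pos t).ne'
  have h2' : (Real.sigmoid (-t) : ℂ) ≠ 0 := by exact_mod_cast (Real.sigmoid_pos (-t)).ne'
  simp only [logisticKernel, neg_neg]
  rw [Complex.cpow_add _ _ h1', Complex.cpow_add _ _ h2']
  ring

/-- **Barnes' first lemma**, along the imaginary axis. -/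
theorem integral_four_Gamma {a b c d : ℂ} (ha : 0 < a.re) (hb : 0 < b.re) (hc : 0 < c.re)
    (hd : 0 < d.re) : ∫ x : ℝ,
      Complex.Gamma (a + Complex.I * x) * Complex.Gamma (b + Complex.I * x) *
        Complex.Gamma (c - Complex.I * x) * Complex.Gamma (d - Complex.I * x) =
    2 * Real.pi * Complex.Gamma (a + c) * Complex.Gamma (b + c) *
      Complex.Gamma (a + d) * Complex.Gamma (b + d) / Complex.Gamma (a + b + c + d) := by
  have h := integral_fourier_logisticKernel_mul ha hb hc hd
  have hac : Complex.Gamma (a + c) ≠ 0 := Complex.Gamma_ne_zero_of_re_pos (by simp; linarith)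
  have hbd : Complex.Gamma (b + d) ≠ 0 := Complex.Gamma_ne_zero_of_re_pos (by simp; linarith)
  -- The rescaling `x = -2πw` undoes the Fourier normalization and produces the factor `2π`.
  have hs := Measure.integral_comp_mul_left (fun x : ℝ =>
      Complex.Gamma (a + Complex.I * x) * Complex.Gamma (b + Complex.I * x) *
        Complex.Gamma (c - Complex.I * x) * Complex.Gamma (d - Complex.I * x)) (-(2 * Real.pi))
  rw [abs_inv, abs_neg, abs_of_pos Real.two_pi_pos, Complex.real_smul] at hs
  rw [Complex.betaIntegral_eq_Gamma_mul_div _ _ (by simp; linarith) (by simp; linarith)] at h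
  simp only [fourier_logisticKernel_eq_Gamma ha hc, fourier_logisticKernel_eq_Gamma hb hd,
    div_mul_div_comm, mul_mul_mul_comm _ (Complex.Gamma (c - _)), ← mul_assoc] at h
  rw [integral_div, hs] at h
  have hpi : (Real.pi : ℂ) ≠ 0 := by exact_mod_cast Real.pi_ne_zero
  have hab : a + d + (b + c) = a + b + c + d := by ring
  rw [hab] at h
  push_cast at h
  field_simp at h
  rw [h]
  ring

/-! ### The density: normalization, parameter shifts, positivity -/

theorem ne_zero_of_re_pos {z : ℂ} (hz : 0 < z.re) : z ≠ 0 := by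
  rintro rfl
  simp at hz

theorem conj_sub_I_mul (z : ℂ) (x : ℝ) :
    conj z - Complex.I * x = conj (z + Complex.I * x) := by
  simp [sub_eq_add_neg]

theorem integrable_continuousHahn {a b c d : ℂ} (ha : 0 < a.re) (hb : 0 < b.re) (hc : 0 < c.re)
    (hd : 0 < d.re) : Integrable fun x : ℝ => continuousHahn x a b c d :=
  ((integrable_four_Gamma ha hb hc hd).const_mul _).div_const _

theorem integral_continuousHahn {a b c d : ℂ} (ha : 0 < a.re) (hb : 0 < b.re) (hc : 0 < c.re)
    (hd : 0 < d.re) : ∫ x : ℝ, continuousHahn x a b c d = 1 := by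
  simp only [continuousHahn]
  rw [integral_div, integral_const_mul, integral_four_Gamma ha hb hc hd]
  have h1 : Complex.Gamma (a + c) ≠ 0 := Complex.Gamma_ne_zero_of_re_pos (by simp; linarith)
  have h2 : Complex.Gamma (b + c) ≠ 0 := Complex.Gamma_ne_zero_of_re_pos (by simp; linarith)
  have h3 : Complex.Gamma (a + d) ≠ 0 := Complex.Gamma_ne_zero_of_re_pos (by simp; linarith)
  have h4 : Complex.Gamma (b + d) ≠ 0 := Complex.Gamma_ne_zero_of_re_pos (by simp; linarith)
  have h5 : Complex.Gamma (a + b + c + d) ≠ 0 :=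
    Complex.Gamma_ne_zero_of_re_pos (by simp; linarith)
  have hpi : (Real.pi : ℂ) ≠ 0 := by exact_mod_cast Real.pi_ne_zero
  field_simp

theorem add_I_mul_mul_continuousHahn {a b c d : ℂ} (ha : 0 < a.re) (hb : 0 < b.re)
    (hc : 0 < c.re) (hd : 0 < d.re) (x : ℝ) :
    (a + Complex.I * x) * continuousHahn x a b c d =
      (a + c) * (a + d) / (a + b + c + d) * continuousHahn x (a + 1) b c d := by
  have hac : a + c ≠ 0 := ne_zero_of_re_pos (by simp; linarith)
  have had : a + d ≠ 0 := ne_zero_of_re_pos (by simp; linarith)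
  have hs : a + b + c + d ≠ 0 := ne_zero_of_re_pos (by simp; linarith)
  have hx : a + Complex.I * x ≠ 0 := ne_zero_of_re_pos (by simpa using ha)
  have e1 : a + 1 + b + c + d = a + b + c + d + 1 := by ring
  have e2 : a + 1 + c = a + c + 1 := by ring
  have e3 : a + 1 + d = a + d + 1 := by ring
  have e4 : a + 1 + Complex.I * x = a + Complex.I * x + 1 := by ring
  simp only [continuousHahn]
  rw [e1, e2, e3, e4, Complex.Gamma_add_one _ hac, Complex.Gamma_add_one _ had,
    Complex.Gamma_add_one _ hs, Complex.Gamma_add_one _ hx]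
  field_simp

theorem sub_I_mul_mul_continuousHahn {a b c d : ℂ} (ha : 0 < a.re) (hb : 0 < b.re)
    (hc : 0 < c.re) (hd : 0 < d.re) (x : ℝ) :
    (c - Complex.I * x) * continuousHahn x a b c d =
      (a + c) * (b + c) / (a + b + c + d) * continuousHahn x a b (c + 1) d := by
  have hac : a + c ≠ 0 := ne_zero_of_re_pos (by simp; linarith)
  have hbc : b + c ≠ 0 := ne_zero_of_re_pos (by simp; linarith)
  have hs : a + b + c + d ≠ 0 := ne_zero_of_re_pos (by simp; linarith)
  have hx : c - Complex.I * x ≠ 0 := ne_zero_of_re_pos (by simpa using hc)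
  have e1 : a + b + (c + 1) + d = a + b + c + d + 1 := by ring
  have e2 : a + (c + 1) = a + c + 1 := by ring
  have e3 : b + (c + 1) = b + c + 1 := by ring
  have e4 : c + 1 - Complex.I * x = c - Complex.I * x + 1 := by ring
  simp only [continuousHahn]
  rw [e1, e2, e3, e4, Complex.Gamma_add_one _ hac, Complex.Gamma_add_one _ hbc,
    Complex.Gamma_add_one _ hs, Complex.Gamma_add_one _ hx]
  field_simp

/-- `Γ(conj z) = conj Γ(z)` makes the Gamma factors pair up into squared moduli. -/
theorem continuousHahn_conj_eq_ofReal (a b : ℂ) (x : ℝ) :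
    continuousHahn x a b (conj a) (conj b) =
      ((Real.Gamma (2 * (a.re + b.re)) * (Complex.normSq (Complex.Gamma (a + Complex.I * x)) *
        Complex.normSq (Complex.Gamma (b + Complex.I * x))) /
        (2 * Real.pi * Real.Gamma (2 * a.re) * Real.Gamma (2 * b.re) *
          Complex.normSq (Complex.Gamma (a + conj b))) : ℝ) : ℂ) := by
  have e1 : a + b + conj a + conj b = ((2 * (a.re + b.re) : ℝ) : ℂ) := by
    apply Complex.ext <;> simp
    ring
  have e2 : ∀ z : ℂ, z + conj z = ((2 * z.re : ℝ) : ℂ) := Complex.add_conj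
  have e4 : b + conj a = conj (a + conj b) := by simp [add_comm]
  simp only [continuousHahn]
  rw [e1, e2, e2, conj_sub_I_mul, conj_sub_I_mul, e4, Complex.Gamma_conj, Complex.Gamma_conj, Complex.Gamma_conj,
    Complex.Gamma_ofReal, Complex.Gamma_ofReal, Complex.Gamma_ofReal]
  push_cast
  rw [Complex.normSq_eq_conj_mul_self, Complex.normSq_eq_conj_mul_self,
    Complex.normSq_eq_conj_mul_self]
  congr 1 <;> ring

theorem continuousHahn_conj_re_nonneg {a b : ℂ} (ha : 0 < a.re) (hb : 0 < b.re) (x : ℝ) :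
    0 ≤ (continuousHahn x a b (conj a) (conj b)).re := by
  rw [continuousHahn_conj_eq_ofReal, Complex.ofReal_re]
  have h1 : 0 < Real.Gamma (2 * (a.re + b.re)) := Real.Gamma_pos_of_pos (by linarith)
  have h2 : 0 < Real.Gamma (2 * a.re) := Real.Gamma_pos_of_pos (by linarith)
  have h3 : 0 < Real.Gamma (2 * b.re) := Real.Gamma_pos_of_pos (by linarith)
  have h4 := Real.pi_pos
  have h5 := Complex.normSq_nonneg
  exact div_nonneg (mul_nonneg h1.le (mul_nonneg (h5 _) (h5 _))) (mul_nonneg (by positivity) (h5 _))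

theorem continuousHahn_conj_im (a b : ℂ) (x : ℝ) :
    (continuousHahn x a b (conj a) (conj b)).im = 0 := by
  rw [continuousHahn_conj_eq_ofReal, Complex.ofReal_im]

theorem measurable_continuousHahn_conj_re {a b : ℂ} (ha : 0 < a.re) (hb : 0 < b.re) :
    Measurable fun x : ℝ => (continuousHahn x a b (conj a) (conj b)).re := by
  have h : ∀ {z : ℂ}, 0 < z.re → Continuous fun x : ℝ => Complex.Gamma (z + Complex.I * x) :=
    fun hz => Complex.continuous_Gamma_comp (by fun_prop) (by simpa using hz)
  simp only [continuousHahn_conj_eq_ofReal, Complex.ofReal_re]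
  exact (((Complex.continuous_normSq.comp (h ha)).mul
    (Complex.continuous_normSq.comp (h hb))).const_mul _).div_const _ |>.measurable

theorem integrable_continuousHahnMeasure_iff {a b : ℂ} (ha : 0 < a.re) (hb : 0 < b.re)
    (g : ℝ → ℝ) : Integrable g (continuousHahnMeasure a b) ↔
      Integrable fun x => (continuousHahn x a b (conj a) (conj b)).re * g x := by
  rw [continuousHahnMeasure, integrable_withDensity_iff_integrable_smul'
    (measurable_continuousHahn_conj_re ha hb).ennreal_ofReal (by simp)]
  simp only [ENNReal.toReal_ofReal (continuousHahn_conj_re_nonneg ha hb _), smul_eq_mul]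

theorem integral_continuousHahnMeasure {a b : ℂ} (ha : 0 < a.re) (hb : 0 < b.re) (g : ℝ → ℝ) :
    ∫ x, g x ∂(continuousHahnMeasure a b) =
      ∫ x, (continuousHahn x a b (conj a) (conj b)).re * g x := by
  rw [continuousHahnMeasure, integral_withDensity_eq_integral_toReal_smul
    (measurable_continuousHahn_conj_re ha hb).ennreal_ofReal (by simp)]
  simp only [ENNReal.toReal_ofReal (continuousHahn_conj_re_nonneg ha hb _), smul_eq_mul]

/-! ### First and second moments about `-Im a` -/

theorem integral_add_im_continuousHahnMeasure {a b : ℂ} (ha : 0 < a.re) (hb : 0 < b.re) :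
    ∫ x, (x + a.im) ∂(continuousHahnMeasure a b) =
      a.re * (a.im - b.im) / (a.re + b.re) := by
  have ha' : 0 < (conj a).re := by simpa using ha
  have hb' : 0 < (conj b).re := by simpa using hb
  have ha1 : 0 < (a + 1).re := by simp; linarith
  have hint := (integrable_continuousHahn ha1 hb ha' hb').const_mul
    ((a + conj a) * (a + conj b) / (a + b + conj a + conj b))
  have hval := integral_const_mul (μ := volume) ((a + conj a) * (a + conj b) / (a + b + conj a + conj b))
    (fun x : ℝ => continuousHahn x (a + 1) b (conj a) (conj b))
  rw [integral_continuousHahn ha1 hb ha' hb', mul_one] at hval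
  rw [integral_continuousHahnMeasure ha hb]
  have him := congrArg Complex.im hval
  rw [← RCLike.im_eq_complex_im, ← integral_im hint, RCLike.im_eq_complex_im] at him
  -- The shifted weight may be non-real, but `φ` itself is real, so only `Im (a + ix) = x + Im a`
  -- survives.
  have hpt : ∀ x : ℝ, (((a + conj a) * (a + conj b) / (a + b + conj a + conj b)) *
      continuousHahn x (a + 1) b (conj a) (conj b)).im =
        (continuousHahn x a b (conj a) (conj b)).re * (x + a.im) := fun x => by
    rw [← add_I_mul_mul_continuousHahn ha hb ha' hb', Complex.mul_im, continuousHahn_conj_im]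
    simp
    ring
  simp only [hpt] at him
  rw [him]
  have e1 : a + b + conj a + conj b = ((2 * (a.re + b.re) : ℝ) : ℂ) := by
    apply Complex.ext <;> simp
    ring
  rw [e1, Complex.add_conj, Complex.div_ofReal_im, Complex.im_ofReal_mul]
  have : a.re + b.re ≠ 0 := by linarith
  simp
  field_simp
  ring

theorem normSq_mul_continuousHahn {a b : ℂ} (ha : 0 < a.re) (hb : 0 < b.re) (x : ℝ) :
    (Complex.normSq (a + Complex.I * x) : ℂ) * continuousHahn x a b (conj a) (conj b) =
      ((2 * a.re * (2 * a.re + 1) * ((a.re + b.re) ^ 2 + (a.im - b.im) ^ 2) /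
        (2 * (a.re + b.re) * (2 * (a.re + b.re) + 1)) : ℝ) : ℂ) *
          continuousHahn x (a + 1) b (conj a + 1) (conj b) := by
  have ha' : 0 < (conj a).re := by simpa using ha
  have hb' : 0 < (conj b).re := by simpa using hb
  have ha1 : 0 < (a + 1).re := by simp; linarith
  have e : (Complex.normSq (a + Complex.I * x) : ℂ) =
      (conj a - Complex.I * x) * (a + Complex.I * x) := by
    rw [Complex.normSq_eq_conj_mul_self, conj_sub_I_mul]
  rw [e, mul_assoc, add_I_mul_mul_continuousHahn ha hb ha' hb', mul_left_comm,
    sub_I_mul_mul_continuousHahn ha1 hb ha' hb', ← mul_assoc]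
  congr 1
  have e1 : a + b + conj a + conj b = ((2 * (a.re + b.re) : ℝ) : ℂ) := by
    apply Complex.ext <;> simp
    ring
  have e2 : a + 1 + b + conj a + conj b = ((2 * (a.re + b.re) + 1 : ℝ) : ℂ) := by
    rw [Complex.ofReal_add, ← e1]
    push_cast
    ring
  have e3 : a + 1 + conj a = ((2 * a.re + 1 : ℝ) : ℂ) := by
    rw [Complex.ofReal_add, ← Complex.add_conj]
    push_cast
    ring
  have e4 : (a + conj b) * (b + conj a) =
      (((a.re + b.re) ^ 2 + (a.im - b.im) ^ 2 : ℝ) : ℂ) := by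
    apply Complex.ext
    · rw [Complex.ofReal_re]
      simp
      ring
    · rw [Complex.ofReal_im]
      simp
      ring
  rw [e1, e2, e3, Complex.add_conj, div_mul_div_comm, mul_mul_mul_comm, e4]
  push_cast
  ring

/-- Uses `|a + ix|² = (Re a)² + (x + Im a)²`; this also reduces integrability of the square to that
of two weights. -/
theorem sq_add_im_mul_continuousHahn_re {a b : ℂ} (ha : 0 < a.re) (hb : 0 < b.re) (x : ℝ) :
    (continuousHahn x a b (conj a) (conj b)).re * (x + a.im) ^ 2 =
      2 * a.re * (2 * a.re + 1) * ((a.re + b.re) ^ 2 + (a.im - b.im) ^ 2) /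
        (2 * (a.re + b.re) * (2 * (a.re + b.re) + 1)) *
          (continuousHahn x (a + 1) b (conj a + 1) (conj b)).re -
        a.re ^ 2 * (continuousHahn x a b (conj a) (conj b)).re := by
  have h := congrArg Complex.re (normSq_mul_continuousHahn ha hb x)
  rw [Complex.re_ofReal_mul, Complex.re_ofReal_mul] at h
  rw [← h, Complex.normSq_apply]
  simp
  ring

theorem integrable_sq_add_im_continuousHahnMeasure {a b : ℂ} (ha : 0 < a.re) (hb : 0 < b.re) :
    Integrable (fun x => (x + a.im) ^ 2) (continuousHahnMeasure a b) := by
  have ha' : 0 < (conj a).re := by simpa using ha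
  have hb' : 0 < (conj b).re := by simpa using hb
  rw [integrable_continuousHahnMeasure_iff ha hb]
  simp only [sq_add_im_mul_continuousHahn_re ha hb]
  exact ((integrable_continuousHahn (a := a + 1) (c := conj a + 1) (by simp; linarith) hb
    (by simp; linarith) hb').re.const_mul _).sub
      ((integrable_continuousHahn ha hb ha' hb').re.const_mul _)

theorem integral_sq_add_im_continuousHahnMeasure {a b : ℂ} (ha : 0 < a.re) (hb : 0 < b.re) :
    ∫ x, (x + a.im) ^ 2 ∂(continuousHahnMeasure a b) =
      2 * a.re * (2 * a.re + 1) * ((a.re + b.re) ^ 2 + (a.im - b.im) ^ 2) /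
        (2 * (a.re + b.re) * (2 * (a.re + b.re) + 1)) - a.re ^ 2 := by
  have ha' : 0 < (conj a).re := by simpa using ha
  have hb' : 0 < (conj b).re := by simpa using hb
  have ha1 : 0 < (a + 1).re := by simp; linarith
  have hc1 : 0 < (conj a + 1).re := by simp; linarith
  have hre : ∀ {f : ℝ → ℂ}, Integrable f → ∫ x, f x = 1 →
      Integrable (fun x => (f x).re) ∧ ∫ x, (f x).re = 1 := fun {f} hf h1 =>
    ⟨hf.re, (integral_re hf).trans (by rw [h1, RCLike.one_re])⟩
  obtain ⟨i1, v1⟩ := hre (integrable_continuousHahn ha1 hb hc1 hb')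
    (integral_continuousHahn ha1 hb hc1 hb')
  obtain ⟨i2, v2⟩ := hre (integrable_continuousHahn ha hb ha' hb')
    (integral_continuousHahn ha hb ha' hb')
  rw [integral_continuousHahnMeasure ha hb]
  simp only [sq_add_im_mul_continuousHahn_re ha hb]
  rw [integral_sub (i1.const_mul _) (i2.const_mul _), integral_const_mul, integral_const_mul,
    v1, v2, mul_one, mul_one]

theorem memLp_add_im_continuousHahnMeasure {a b : ℂ} (ha : 0 < a.re) (hb : 0 < b.re) :
    MemLp (fun x => x + a.im) 2 (continuousHahnMeasure a b) :=
  (memLp_two_iff_integrable_sq (by fun_prop)).2 (integrable_sq_add_im_continuousHahnMeasure ha hb)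

/-! ### Transfer to random variables -/

theorem proposition4p1 (a b : ℂ) (ha : 0 < a.re) (hb : 0 < b.re) :
    -- `x ↦ φ(x; a, b, conj a, conj b)` is a probability density on the real line
    ((∀ x : ℝ, (continuousHahn x a b (conj a) (conj b)).im = 0 ∧
        0 ≤ (continuousHahn x a b (conj a) (conj b)).re) ∧
      Integrable (fun x : ℝ => continuousHahn x a b (conj a) (conj b)) volume ∧
      ∫ x : ℝ, continuousHahn x a b (conj a) (conj b) = 1) ∧
    -- mean and variance of every random variable with this density
    ∀ {Ω : Type*} [MeasurableSpace Ω] (P : Measure Ω) [IsProbabilityMeasure P] (X : Ω → ℝ),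
      HasLaw X (continuousHahnMeasure a b) P →
        MemLp X 2 P ∧
        ∫ ω, X ω ∂P = -((a.re * b.im + b.re * a.im) / (a + b).re) ∧
        variance X P =
          a.re * b.re * ((a + b).re ^ 2 + (a - b).im ^ 2) /
            ((a + b).re ^ 2 * (2 * (a + b).re + 1)) := by
  have ha' : 0 < (conj a).re := by simpa using ha
  have hb' : 0 < (conj b).re := by simpa using hb
  refine ⟨⟨fun x => ⟨continuousHahn_conj_im a b x, continuousHahn_conj_re_nonneg ha hb x⟩,
    integrable_continuousHahn ha hb ha' hb', integral_continuousHahn ha hb ha' hb'⟩, ?_⟩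
  intro Ω _ P _ X hX
  have hY : MemLp (fun ω => X ω + a.im) 2 P := by
    have h := memLp_add_im_continuousHahnMeasure ha hb
    rw [← hX.map_eq] at h
    exact h.comp_of_map hX.aemeasurable
  have hXm : MemLp X 2 P := by
    convert hY.sub (memLp_const a.im) using 1
    ext ω
    simp
  have hX1 : Integrable X P := hXm.integrable one_le_two
  have m1 : ∫ ω, (X ω + a.im) ∂P = a.re * (a.im - b.im) / (a.re + b.re) := by
    rw [← integral_add_im_continuousHahnMeasure ha hb]
    exact hX.integral_comp (f := fun x => x + a.im) (by fun_prop)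
  have m2 : ∫ ω, (X ω + a.im) ^ 2 ∂P = _ :=
    (hX.integral_comp (f := fun x => (x + a.im) ^ 2) (by fun_prop)).trans
      (integral_sq_add_im_continuousHahnMeasure ha hb)
  have hs : a.re + b.re ≠ 0 := by linarith
  have hs1 : 2 * (a.re + b.re) + 1 ≠ 0 := by linarith
  refine ⟨hXm, ?_, ?_⟩
  · rw [integral_add hX1 (integrable_const _)] at m1
    simp only [integral_const, probReal_univ, one_smul] at m1
    rw [eq_sub_of_add_eq m1, Complex.add_re]
    field_simp
    ring
  -- Variance is translation invariant, so the moments of `X + Im a` suffice.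
  · rw [← variance_add_const hXm.1 a.im, variance_eq_sub hY]
    simp only [Pi.pow_apply]
    rw [m1, m2, Complex.add_re, Complex.sub_im]
    field_simp
    ring
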